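/- \textbf{Conventions.} A continuum is a nonempty compact connected metrizable space. For a point $x$ of a space $X$, the order $\operatorname{ord}(x,X)$ is the least cardinal $\kappa$ such that every open neighborhood $U$ of $x$ contains an open neighborhood $V$ of $x$ whose boundary has at most $\kappa$ points. $E(X)=\{x\in X:\operatorname{ord}(x,X)=1\}$ is the set of endpoints of $X$ and $B(X)=\{x\in X:\operatorname{ord}(x,X)\ge 3\}$ the set of branchpoints of $X$. An arc is a space homeomorphic to $[0,1]$. An arc $\alpha\subseteq X$ is a free arc in $X$ if its interior $\alpha^\circ=\alpha\setminus E(\alpha)$ is open in $X$. A finite graph is a continuum that is the union of finitely many arcs, any two of which are either disjoint or intersect only in one or both of their endpoints. A tame partition for a continuum $G$ is a countable family of free arcs in $G$ whose interiors $\alpha^\circ$ are pairwise disjoint and whose union has countable complement in $G$. Countable means finite (possibly empty) or countably infinite. \textbf{Theorem.} The following conditions are equivalent for a continuum $G$: \begin{itemize} \item[(i)] $G$ is a tame graph, that is, the closure of $E(G)\cup B(G)$ is countable. \item[(ii)] $G$ is the union of countably many free arcs and a countable set. \item[(iii)] $G$ admits a tame partition. \item[(iv)] Each point of $G$, with at most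 countably many exceptions, has a neighborhood that is a finite graph. \end{itemize} -/

import Mathlib

open Set Topology unitInterval

universe u

namespace TameGraph

/-- The (Menger–Urysohn) order `ord(x, X)` of a point `x` in a space `X`: the least cardinal `κ`
such that every open neighborhood `U` of `x` contains an open neighborhood `V` of `x` whose
boundary has cardinality at most `κ`. -/
noncomputable def ord {X : Type u} [TopologicalSpace X] (x : X) : Cardinal.{u} :=
  sInf {κ : Cardinal.{u} | ∀ U : Set X, IsOpen U → x ∈ U →
    ∃ V : Set X, IsOpen V ∧ x ∈ V ∧ V ⊆ U ∧ Cardinal.mk (frontier V) ≤ κ}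

/-- The infimum in the definition of the order is over a nonempty set and is attained. -/
theorem ord_le_iff {X : Type u} [TopologicalSpace X] (x : X) (κ : Cardinal.{u}) :
    ord x ≤ κ ↔ ∀ U : Set X, IsOpen U → x ∈ U →
      ∃ V : Set X, IsOpen V ∧ x ∈ V ∧ V ⊆ U ∧ Cardinal.mk (frontier V) ≤ κ := by
  constructor
  · intro h U hU hx
    have hne : {κ : Cardinal.{u} | ∀ U : Set X, IsOpen U → x ∈ U →
        ∃ V : Set X, IsOpen V ∧ x ∈ V ∧ V ⊆ U ∧ Cardinal.mk (frontier V) ≤ κ}.Nonempty :=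
      ⟨Cardinal.mk X, fun U hU hx => ⟨U, hU, hx, Subset.rfl, Cardinal.mk_set_le _⟩⟩
    obtain ⟨V, h1, h2, h3, h4⟩ := csInf_mem hne U hU hx
    exact ⟨V, h1, h2, h3, h4.trans h⟩
  · intro h
    exact csInf_le' h

/-- `E(X)`: the endpoints of `X`, i.e. the points of order one. -/
def endpoints (X : Type u) [TopologicalSpace X] : Set X :=
  {x | ord x = 1}

/-- `B(X)`: the branchpoints of `X`, i.e. the points of order at least three. -/
def branchpoints (X : Type u) [TopologicalSpace X] : Set X :=
  {x | 3 ≤ ord x}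

/-- `E(α)` for a subset `α` of `X`: the endpoints of the subspace `α`, as a subset of `X`. -/
def endpointsOf {X : Type u} [TopologicalSpace X] (α : Set X) : Set X :=
  Subtype.val '' endpoints α

/-- An arc: a subspace homeomorphic to the closed unit interval. -/
def IsArc {X : Type u} [TopologicalSpace X] (α : Set X) : Prop :=
  Nonempty (I ≃ₜ α)

/-- `α° = α \ E(α)`. -/
def arcInterior {X : Type u} [TopologicalSpace X] (α : Set X) : Set X :=
  α \ endpointsOf α

/-- A free arc in `X`: an arc `α` such that `α°` is open in `X`. -/
def IsFreeArc {X : Type u} [TopologicalSpace X] (α : Set X) : Prop :=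
  IsArc α ∧ IsOpen (arcInterior α)

/-- A finite graph: a connected space that is the union of finitely many arcs, any two of which
are disjoint or intersect only in one or both of their endpoints. -/
def IsFiniteGraph {X : Type u} [TopologicalSpace X] (S : Set X) : Prop :=
  IsConnected S ∧ ∃ 𝒜 : Set (Set X), 𝒜.Finite ∧ (∀ α ∈ 𝒜, IsArc α) ∧
    (∀ α ∈ 𝒜, ∀ β ∈ 𝒜, α ≠ β → α ∩ β ⊆ endpointsOf α ∩ endpointsOf β) ∧ ⋃₀ 𝒜 = S

/-- A tame graph (for a continuum `G`): the closure of `E(G) ∪ B(G)` is countable. -/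
def IsTameGraph (G : Type u) [TopologicalSpace G] : Prop :=
  (closure (endpoints G ∪ branchpoints G)).Countable

/-- A tame partition: a countable family of free arcs with pairwise disjoint interiors covering
the space up to a countable set of points. -/
def IsTamePartition {G : Type u} [TopologicalSpace G] (P : Set (Set G)) : Prop :=
  P.Countable ∧ (∀ α ∈ P, IsFreeArc α) ∧
    (∀ α ∈ P, ∀ β ∈ P, α ≠ β → Disjoint (arcInterior α) (arcInterior β)) ∧ (⋃₀ P)ᶜ.Countable

end TameGraph

/-!
Each condition is equivalent to the countability of the complement of the union of the interiors
of all free arcs. The crux is that a point `x` of order two is interior to a free arc as soon as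
all points near `x` have order at most two. Let `K` be a continuum irreducible between two points,
all of whose points have order at most two. Each inner point of `K` separates `K` between the two
points, which orders `K` linearly; a weighted sum of distance functions embeds this order in `ℝ`,
so `K` is an arc. Its inner points are interior to it because they have small neighborhoods whose
boundaries consist of two points of `K`. Such arcs exist near `x`, and if `x` does not have order
one, then one of them passes through `x`.
-/

namespace TameGraph

section Connectedness

variable {X : Type u} [TopologicalSpace X]

theorem subset_of_isPreconnected_of_disjoint_frontier {S D : Set X} (hS : IsPreconnected S)
    (hSD : (S ∩ D).Nonempty) (hd : Disjoint S (frontier D)) : S ⊆ D := by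
  obtain ⟨x, hxS, hxD⟩ := hSD
  have hcover : S ⊆ interior D ∪ (closure D)ᶜ := fun z hz =>
    or_iff_not_imp_left.2 fun hInt hcl => disjoint_left.1 hd hz ⟨hcl, hInt⟩
  refine (hS.subset_left_of_subset_union isOpen_interior isClosed_closure.isOpen_compl
    (disjoint_compl_right.mono_left interior_subset_closure) hcover
    ⟨x, hxS, (hcover hxS).resolve_right (not_not.2 (subset_closure hxD))⟩).trans interior_subset

theorem exists_isClosed_disjoint_union_eq_of_not_isPreconnected {S : Set X} (hS : IsClosed S)
    (hconn : ¬ IsPreconnected S) : ∃ A B : Set X, IsClosed A ∧ IsClosed B ∧ A.Nonempty ∧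
      B.Nonempty ∧ Disjoint A B ∧ A ∪ B = S := by
  rw [isPreconnected_iff_subset_of_fully_disjoint_closed hS] at hconn
  push Not at hconn
  obtain ⟨u, v, hu, hv, huv, hd, hSu, hSv⟩ := hconn
  refine ⟨S ∩ u, S ∩ v, hS.inter hu, hS.inter hv, ?_, ?_,
    hd.mono inter_subset_right inter_subset_right, ?_⟩
  · obtain ⟨x, hx, hxv⟩ := not_subset.1 hSv
    exact ⟨x, hx, (huv hx).resolve_right hxv⟩
  · obtain ⟨x, hx, hxu⟩ := not_subset.1 hSu
    exact ⟨x, hx, (huv hx).resolve_left hxu⟩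
  · rw [← inter_union_distrib_left, inter_eq_left.2 huv]

theorem isPreconnected_of_union_of_inter_subset_singleton {A B : Set X} {c : X}
    (hAB : IsPreconnected (A ∪ B)) (hA : IsClosed A) (hB : IsClosed B) (hinter : A ∩ B ⊆ {c})
    (hc : c ∈ A) : IsPreconnected A := by
  classical
  -- `A` is the image of `A ∪ B` under the retraction that collapses `B` to `c`.
  let r : X → X := A.piecewise id fun _ => c
  have hrA : EqOn r id A := piecewise_eqOn _ _ _
  have hrB : EqOn r (fun _ => c) B := fun x hx => by
    by_cases hxA : x ∈ A
    · exact (hrA hxA).trans (hinter ⟨hxA, hx⟩)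
    · exact piecewise_eq_of_notMem _ _ _ hxA
  have hr : ContinuousOn r (A ∪ B) :=
    (continuousOn_id.congr hrA).union_of_isClosed (continuousOn_const.congr hrB) hA hB
  have himage : r '' (A ∪ B) = A := by
    rw [image_union, hrA.image_eq, hrB.image_eq, image_id, union_eq_left]
    rintro _ ⟨-, -, rfl⟩
    exact hc
  exact himage ▸ hAB.image r hr

theorem isClosed_connectedComponentIn {S : Set X} {x : X} (hS : IsClosed S) :
    IsClosed (connectedComponentIn S x) := by
  by_cases hx : x ∈ S
  · rw [connectedComponentIn_eq_image hx]
    exact hS.isClosedEmbedding_subtypeVal.isClosedMap _ isClosed_connectedComponent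
  · rw [connectedComponentIn_eq_empty hx]
    exact isClosed_empty

variable [CompactSpace X] [T2Space X]

theorem isPreconnected_sInter_of_isChain {c : Set (Set X)} (hc : IsChain (· ⊆ ·) c)
    (hne : c.Nonempty) (hclosed : ∀ M ∈ c, IsClosed M) (hconn : ∀ M ∈ c, IsPreconnected M) :
    IsPreconnected (⋂₀ c) := by
  rw [isPreconnected_iff_subset_of_fully_disjoint_closed (isClosed_sInter hclosed)]
  intro u v hu hv huv hd
  obtain ⟨U, V, hU, hV, huU, hvV, hUV⟩ :=
    SeparatedNhds.of_isCompact_isCompact hu.isCompact hv.isCompact hd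
  have : Nonempty c := hne.to_subtype
  obtain ⟨⟨M, hMc⟩, hM⟩ := exists_subset_nhds_of_compactSpace (V := fun M : c => (M : Set X))
    (fun s t => (hc.total s.2 t.2).elim (fun h => ⟨s, Subset.rfl, h⟩) fun h => ⟨t, h, Subset.rfl⟩)
    (fun M => hclosed M M.2) (fun x hx =>
      (hU.union hV).mem_nhds (union_subset_union huU hvV (huv (by rwa [sInter_eq_iInter]))))
  have hsub : ⋂₀ c ⊆ M := sInter_subset_of_mem hMc
  refine ((hconn M hMc).subset_or_subset hU hV hUV hM).imp (fun h x hx => ?_) fun h x hx => ?_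
  · exact (huv hx).resolve_right fun hxv => disjoint_left.1 hUV (h (hsub hx)) (hvV hxv)
  · exact (huv hx).resolve_left fun hxu => disjoint_left.1 hUV (huU hxu) (h (hsub hx))

theorem exists_isClopen_of_connectedComponent_subset {O : Set X} {x : X} (hO : IsOpen O)
    (h : connectedComponent x ⊆ O) : ∃ T, IsClopen T ∧ x ∈ T ∧ T ⊆ O := by
  rw [connectedComponent_eq_iInter_isClopen] at h
  have : Nonempty {s : Set X // IsClopen s ∧ x ∈ s} := ⟨⟨univ, isClopen_univ, trivial⟩⟩
  obtain ⟨T, hTO⟩ := exists_subset_nhds_of_compactSpace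
    (V := fun s : {s : Set X // IsClopen s ∧ x ∈ s} => (s : Set X))
    (fun s t => ⟨⟨s ∩ t, s.2.1.inter t.2.1, s.2.2, t.2.2⟩, inter_subset_left, inter_subset_right⟩)
    (fun s => s.2.1.isClosed) fun z hz => hO.mem_nhds (h hz)
  exact ⟨T, T.2.1, T.2.2, hTO⟩

theorem exists_isOpen_inter_of_connectedComponentIn_subset {S O : Set X} {x : X}
    (hS : IsClosed S) (hx : x ∈ S) (hO : IsOpen O) (h : connectedComponentIn S x ⊆ O) :
    ∃ W, IsOpen W ∧ x ∈ W ∧ IsClosed (S ∩ W) ∧ S ∩ W ⊆ O := by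
  have : CompactSpace S := isCompact_iff_compactSpace.1 hS.isCompact
  rw [connectedComponentIn_eq_image hx, image_subset_iff] at h
  obtain ⟨T, hT, hxT, hTO⟩ := exists_isClopen_of_connectedComponent_subset
    (hO.preimage continuous_subtype_val) h
  obtain ⟨W, hW, rfl⟩ := isOpen_induced_iff.1 hT.isOpen
  refine ⟨W, hW, hxT, ?_, ?_⟩ <;> rw [← Subtype.image_preimage_val]
  · exact hS.isClosedEmbedding_subtypeVal.isClosedMap _ hT.isClosed
  · exact image_subset_iff.2 hTO

variable [PreconnectedSpace X]

theorem connectedComponentIn_inter_frontier_nonempty {S : Set X} {x : X} (hS : IsClosed S)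
    (hx : x ∈ S) (hSu : S ≠ univ) : (connectedComponentIn S x ∩ frontier S).Nonempty := by
  rw [← not_disjoint_iff_nonempty_inter]
  intro hd
  obtain ⟨W, hW, hxW, hclosed, hsub⟩ := exists_isOpen_inter_of_connectedComponentIn_subset hS hx
    isClosed_frontier.isOpen_compl hd.subset_compl_right
  have hInt : S ∩ W = interior S ∩ W := by
    refine Subset.antisymm (fun z hz => ⟨?_, hz.2⟩) (inter_subset_inter_left _ interior_subset)
    exact not_not.1 fun hi => hsub hz ⟨subset_closure hz.1, hi⟩
  have huniv : S ∩ W = univ :=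
    IsClopen.eq_univ ⟨hclosed, hInt ▸ isOpen_interior.inter hW⟩ ⟨x, hx, hxW⟩
  exact hSu (univ_subset_iff.1 (huniv ▸ inter_subset_left))

theorem closure_connectedComponentIn_compl_inter_nonempty {K : Set X} {y : X} (hK : IsClosed K)
    (hne : K.Nonempty) (hy : y ∉ K) : (closure (connectedComponentIn Kᶜ y) ∩ K).Nonempty := by
  rw [← not_disjoint_iff_nonempty_inter]
  intro hd
  obtain ⟨U, V, hU, hV, hYU, hKV, hUV⟩ := SeparatedNhds.of_isCompact_isCompact
    isClosed_closure.isCompact hK.isCompact hd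
  have hyV : y ∉ V := disjoint_left.1 hUV (hYU (subset_closure (mem_connectedComponentIn hy)))
  obtain ⟨k, hk⟩ := hne
  obtain ⟨z, hz, hzV⟩ := connectedComponentIn_inter_frontier_nonempty hV.isClosed_compl hyV
    (ne_univ_iff_exists_notMem _ |>.2 ⟨k, not_not.2 (hKV hk)⟩)
  have hzU : z ∈ U :=
    hYU (subset_closure (connectedComponentIn_mono y (compl_subset_compl.2 hKV) hz))
  rw [frontier_compl] at hzV
  exact disjoint_left.1 (hUV.closure_right hU) hzU hzV.1

theorem eventually_eq_of_connectedComponentIn_subset_singleton {Z : Set X} {x : X}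
    (hZ : IsClosed Z) (hx : x ∈ Z) (hfr : ∀ᶠ z in 𝓝 x, z ∈ frontier Z → z = x)
    (hcomp : connectedComponentIn Z x ⊆ {x}) : ∀ᶠ z in 𝓝 x, z ∈ Z → z = x := by
  obtain ⟨V, hVfr, hV, hxV⟩ := eventually_nhds_iff.1 hfr
  obtain ⟨W, hW, hxW, hclosed, hsub⟩ := exists_isOpen_inter_of_connectedComponentIn_subset hZ hx
    hV (hcomp.trans (singleton_subset_iff.2 hxV))
  have hfrZW : frontier (Z ∩ W) ⊆ {x} := fun z hz => by
    have hzZW : z ∈ Z ∩ W := hclosed.frontier_subset hz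
    refine hVfr z (hsub hzZW) ⟨subset_closure hzZW.1, fun hInt => hz.2 ?_⟩
    rw [interior_inter, hW.interior_eq]
    exact ⟨hInt, hzZW.2⟩
  filter_upwards [hW.mem_nhds hxW] with y hyW hyZ
  have hxy : x ∈ connectedComponentIn (Z ∩ W) y := by
    by_cases huniv : Z ∩ W = univ
    · rw [huniv, connectedComponentIn_univ, PreconnectedSpace.connectedComponent_eq_univ]
      trivial
    · obtain ⟨z, hzy, hz⟩ := connectedComponentIn_inter_frontier_nonempty hclosed ⟨hyZ, hyW⟩ huniv
      exact hfrZW hz ▸ hzy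
  refine hcomp (connectedComponentIn_mono x (inter_subset_left (t := W)) ?_)
  rw [← connectedComponentIn_eq hxy]
  exact mem_connectedComponentIn ⟨hyZ, hyW⟩

end Connectedness

section OrderedContinua

theorem orderClosedTopology_of_isOpen_Iio_Ioi {X : Type*} [TopologicalSpace X] [LinearOrder X]
    (hIio : ∀ p : X, IsOpen (Iio p)) (hIoi : ∀ p : X, IsOpen (Ioi p)) :
    OrderClosedTopology X := by
  refine ⟨isOpen_compl_iff.1 (isOpen_iff_mem_nhds.2 ?_)⟩
  rintro ⟨x, y⟩ hxy
  have hyx : y < x := not_le.1 hxy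
  by_cases hbetween : ∃ z, y < z ∧ z < x
  · obtain ⟨z, hyz, hzx⟩ := hbetween
    filter_upwards [prod_mem_nhds ((hIoi z).mem_nhds hzx) ((hIio z).mem_nhds hyz)]
      with q hq hle
    exact (hq.2.trans hq.1).not_ge hle
  · filter_upwards [prod_mem_nhds ((hIoi y).mem_nhds hyx) ((hIio x).mem_nhds hyx)]
      with q hq hle
    exact hbetween ⟨q.1, hq.1, lt_of_le_of_lt hle hq.2⟩

variable {X : Type*} [LinearOrder X]

section MetricSpace

open Metric

variable [MetricSpace X] [CompactSpace X] [OrderClosedTopology X]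

theorem continuous_infDist_Iic (d : X) : Continuous fun p => infDist d (Iic p) := by
  have hlower (r : ℝ) : (fun p => infDist d (Iic p)) ⁻¹' Iic r =
      Prod.snd '' ({q : X × X | q.1 ≤ q.2} ∩ {q | dist d q.1 ≤ r}) := by
    ext p
    constructor
    · intro hp
      obtain ⟨y, hyp, hy⟩ := isClosed_Iic.isCompact.exists_infDist_eq_dist nonempty_Iic d
      exact ⟨(y, p), ⟨hyp, hy.symm.trans_le hp⟩, rfl⟩
    · rintro ⟨⟨y, p⟩, ⟨hyp, hy⟩, rfl⟩
      exact (infDist_le_dist_of_mem (mem_Iic.2 hyp)).trans hy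
  have hupper (r : ℝ) : (fun p => infDist d (Iic p)) ⁻¹' Iio r =
      ball d r ∪ ⋃ x ∈ ball d r, Ioi x := by
    ext p
    simp only [mem_preimage, mem_Iio, infDist_lt_iff nonempty_Iic, mem_union, mem_iUnion,
      exists_prop, mem_ball', mem_Ioi, mem_Iic, le_iff_eq_or_lt]
    grind
  refine continuous_iff_lower_upperSemicontinuous.2 ⟨?_, ?_⟩
  · refine lowerSemicontinuous_iff_isClosed_preimage.2 fun r => hlower r ▸ ?_
    exact isClosedMap_snd_of_compactSpace _ (OrderClosedTopology.isClosed_le'.inter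
      (isClosed_le (by fun_prop) continuous_const))
  · refine upperSemicontinuous_iff_isOpen_preimage.2 fun r => hupper r ▸ ?_
    exact isOpen_ball.union (isOpen_biUnion fun x _ => isOpen_Ioi)

/-- The function is `-∑ₙ 2⁻ⁿ dist (sₙ, Iic p)` for a dense sequence `s`. -/
theorem exists_continuous_strictMono : ∃ F : X → ℝ, Continuous F ∧ StrictMono F := by
  cases isEmpty_or_nonempty X
  · exact ⟨isEmptyElim, by fun_prop, isEmptyElim⟩
  let f (n : ℕ) (p : X) : ℝ := (1 / 2) ^ n * infDist (TopologicalSpace.denseSeq X n) (Iic p)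
  have hf_norm (n : ℕ) (p : X) : ‖f n p‖ ≤ (1 / 2) ^ n * diam (univ : Set X) := by
    rw [Real.norm_of_nonneg (mul_nonneg (by positivity) infDist_nonneg)]
    gcongr
    exact (infDist_le_dist_of_mem self_mem_Iic).trans
      (dist_le_diam_of_mem isCompact_univ.isBounded trivial trivial)
  have hsum : Summable fun n : ℕ => (1 / 2 : ℝ) ^ n * diam (univ : Set X) :=
    summable_geometric_two.mul_right _
  have hf_sum (p : X) : Summable fun n => f n p := .of_norm_bounded hsum fun n => hf_norm n p
  refine ⟨fun p => -∑' n, f n p, (continuous_tsum (fun n =>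
    continuous_const.mul (continuous_infDist_Iic _)) hsum hf_norm).neg, fun x p hxp => ?_⟩
  have hpos : 0 < infDist p (Iic x) :=
    (isClosed_Iic.notMem_iff_infDist_pos nonempty_Iic).1 hxp.not_ge
  obtain ⟨n, hn⟩ := (TopologicalSpace.denseRange_denseSeq X).exists_dist_lt p (half_pos hpos)
  have hlt : infDist (TopologicalSpace.denseSeq X n) (Iic p) <
      infDist (TopologicalSpace.denseSeq X n) (Iic x) := by
    have hle := infDist_le_dist_of_mem (x := TopologicalSpace.denseSeq X n) (self_mem_Iic (a := p))
    have htri := infDist_le_infDist_add_dist (s := Iic x) (x := p)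
      (y := TopologicalSpace.denseSeq X n)
    rw [dist_comm] at hle
    linarith
  refine neg_lt_neg ((hf_sum p).tsum_lt_tsum (i := n) (fun m => ?_) ?_ (hf_sum x))
  · exact mul_le_mul_of_nonneg_left
      (infDist_le_infDist_of_subset (Iic_subset_Iic.2 hxp.le) nonempty_Iic) (by positivity)
  · exact mul_lt_mul_of_pos_left hlt (by positivity)

end MetricSpace

theorem exists_homeomorph_of_isBot_of_isTop [TopologicalSpace X]
    [TopologicalSpace.MetrizableSpace X] [CompactSpace X] [PreconnectedSpace X]
    [OrderClosedTopology X] {a b : X} (ha : IsBot a) (hb : IsTop b) (hab : a ≠ b) :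
    ∃ e : I ≃ₜ X, e 0 = a ∧ e 1 = b := by
  let _ : MetricSpace X := TopologicalSpace.metrizableSpaceMetric X
  obtain ⟨F, hF, hmono⟩ := exists_continuous_strictMono (X := X)
  have hrange : range F = Icc (F a) (F b) := by
    refine Subset.antisymm ?_ ((isPreconnected_range hF).Icc_subset ⟨a, rfl⟩ ⟨b, rfl⟩)
    rintro _ ⟨x, rfl⟩
    exact ⟨hmono.monotone (ha x), hmono.monotone (hb x)⟩
  have hFab : F a < F b := hmono ((ha b).lt_of_ne hab)
  let e : X ≃ₜ I := ((hF.isClosedEmbedding hmono.injective).isEmbedding.toHomeomorph.trans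
    (Homeomorph.setCongr hrange)).trans (iccHomeoI (F a) (F b) hFab)
  refine ⟨e.symm, e.symm_apply_eq.2 (Subtype.ext ?_), e.symm_apply_eq.2 (Subtype.ext ?_)⟩
  · change (0 : ℝ) = (F a - F a) / (F b - F a)
    rw [sub_self, zero_div]
  · change (1 : ℝ) = (F b - F a) / (F b - F a)
    rw [div_self (sub_pos.2 hFab).ne']

end OrderedContinua

/-- A choice, for each point `p`, of a partition of the complement of `p` into two open sets
`P p` and `Q p` such that neither `a` lies in `Q p` nor `b` in `P p`. In a connected space,
`x ∈ P p` is then a linear order `x < p`. -/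
structure IsCutSystem {X : Type*} [TopologicalSpace X] (a b : X) (P Q : X → Set X) : Prop where
  isOpen_left : ∀ p, IsOpen (P p)
  isOpen_right : ∀ p, IsOpen (Q p)
  disjoint : ∀ p, Disjoint (P p) (Q p)
  union_eq : ∀ p, P p ∪ Q p = {p}ᶜ
  left_mem : ∀ p, a ∈ insert p (P p)
  right_mem : ∀ p, b ∈ insert p (Q p)

namespace IsCutSystem

variable {X : Type*} [TopologicalSpace X] {a b : X} {P Q : X → Set X}

theorem symm (h : IsCutSystem a b P Q) : IsCutSystem b a Q P :=
  ⟨h.isOpen_right, h.isOpen_left, fun p => (h.disjoint p).symm,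
    fun p => (union_comm _ _).trans (h.union_eq p), h.right_mem, h.left_mem⟩

theorem mem_or_mem_iff_ne (h : IsCutSystem a b P Q) {x p : X} : x ∈ P p ∨ x ∈ Q p ↔ x ≠ p :=
  Set.ext_iff.1 (h.union_eq p) x

theorem notMem_left (h : IsCutSystem a b P Q) (p : X) : p ∉ P p := fun hp =>
  h.mem_or_mem_iff_ne.1 (Or.inl hp) rfl

theorem insert_left_eq_compl (h : IsCutSystem a b P Q) (p : X) : insert p (P p) = (Q p)ᶜ := by
  ext x
  have hdisj : x ∈ P p → x ∉ Q p := fun hx => disjoint_left.1 (h.disjoint p) hx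
  have hcover := h.mem_or_mem_iff_ne (x := x) (p := p)
  simp only [mem_insert_iff, mem_compl_iff]
  tauto

theorem isClosed_insert_left (h : IsCutSystem a b P Q) (p : X) : IsClosed (insert p (P p)) :=
  h.insert_left_eq_compl p ▸ (h.isOpen_right p).isClosed_compl

variable [PreconnectedSpace X]

theorem isPreconnected_insert_left (h : IsCutSystem a b P Q) (p : X) :
    IsPreconnected (insert p (P p)) := by
  have hunion : insert p (P p) ∪ insert p (Q p) = univ := by
    rw [← insert_union_distrib, h.union_eq, insert_eq, union_compl_self]
  have hinter : insert p (P p) ∩ insert p (Q p) = {p} := by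
    rw [← insert_inter_distrib, (h.disjoint p).inter_eq, insert_empty_eq]
  exact isPreconnected_of_union_of_inter_subset_singleton (hunion ▸ isPreconnected_univ)
    (h.isClosed_insert_left p) (h.symm.isClosed_insert_left p) hinter.subset (mem_insert _ _)

theorem mem_right_of_mem_left (h : IsCutSystem a b P Q) {x p : X} (hx : x ∈ P p) : p ∈ Q x := by
  have hxQ : x ∉ insert p (Q p) := h.symm.insert_left_eq_compl p ▸ not_not.2 hx
  have hsub : insert p (Q p) ⊆ P x ∪ Q x := by
    rw [h.union_eq]
    exact subset_compl_singleton_iff.2 hxQ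
  have hb : b ∈ Q x := (h.right_mem x).resolve_left fun hbx => hxQ (hbx ▸ h.right_mem p)
  exact (h.symm.isPreconnected_insert_left p).subset_right_of_subset_union (h.isOpen_left x)
    (h.isOpen_right x) (h.disjoint x) hsub ⟨b, h.right_mem p, hb⟩ (mem_insert _ _)

theorem mem_left_iff_mem_right (h : IsCutSystem a b P Q) {x p : X} : x ∈ P p ↔ p ∈ Q x :=
  ⟨h.mem_right_of_mem_left, h.symm.mem_right_of_mem_left⟩

theorem left_subset_left (h : IsCutSystem a b P Q) {x p : X} (hx : x ∈ P p) : P x ⊆ P p := by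
  have hp : p ∉ insert x (P x) :=
    h.insert_left_eq_compl x ▸ not_not.2 (h.mem_right_of_mem_left hx)
  have hsub : insert x (P x) ⊆ P p ∪ Q p := by
    rw [h.union_eq]
    exact subset_compl_singleton_iff.2 hp
  exact (subset_insert _ _).trans ((h.isPreconnected_insert_left x).subset_left_of_subset_union
    (h.isOpen_left p) (h.isOpen_right p) (h.disjoint p) hsub ⟨x, mem_insert _ _, hx⟩)

theorem isStrictTotalOrder (h : IsCutSystem a b P Q) :
    IsStrictTotalOrder X fun x p => x ∈ P p where
  irrefl := h.notMem_left
  trans _ _ _ hxy hyz := h.left_subset_left hyz hxy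
  trichotomous x p hxp hpx := by
    by_contra hne
    exact (h.mem_or_mem_iff_ne.2 hne).elim hxp fun hx => hpx (h.mem_left_iff_mem_right.2 hx)

theorem exists_homeomorph [TopologicalSpace.MetrizableSpace X] [CompactSpace X]
    (h : IsCutSystem a b P Q) (hab : a ≠ b) : ∃ e : I ≃ₜ X, e 0 = a ∧ e 1 = b := by
  classical
  have := h.isStrictTotalOrder
  let _ : LinearOrder X := linearOrderOfSTO fun x p => x ∈ P p
  have hIoi (p : X) : Ioi p = Q p := Set.ext fun _ => h.mem_left_iff_mem_right
  have : OrderClosedTopology X := orderClosedTopology_of_isOpen_Iio_Ioi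
    (fun p => h.isOpen_left p) fun p => hIoi p ▸ h.isOpen_right p
  exact exists_homeomorph_of_isBot_of_isTop (fun p => h.left_mem p)
    (fun p => (h.right_mem p).imp Eq.symm h.mem_left_iff_mem_right.2) hab

end IsCutSystem

theorem exists_homeomorph_of_separating {X : Type*} [TopologicalSpace X]
    [TopologicalSpace.MetrizableSpace X] [CompactSpace X] [PreconnectedSpace X] {a b : X}
    (hab : a ≠ b)
    (h : ∀ p, p ≠ a → p ≠ b → ∃ P Q : Set X, IsOpen P ∧ IsOpen Q ∧ Disjoint P Q ∧
      P ∪ Q = {p}ᶜ ∧ a ∈ P ∧ b ∈ Q) :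
    ∃ e : I ≃ₜ X, e 0 = a ∧ e 1 = b := by
  have hcut (p : X) : ∃ P Q : Set X, IsOpen P ∧ IsOpen Q ∧ Disjoint P Q ∧ P ∪ Q = {p}ᶜ ∧
      a ∈ insert p P ∧ b ∈ insert p Q := by
    rcases eq_or_ne p a with rfl | hpa
    · exact ⟨∅, {p}ᶜ, isOpen_empty, isOpen_compl_singleton, empty_disjoint _, empty_union _,
        Or.inl rfl, Or.inr hab.symm⟩
    rcases eq_or_ne p b with rfl | hpb
    · exact ⟨{p}ᶜ, ∅, isOpen_compl_singleton, isOpen_empty, disjoint_empty _, union_empty _,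
        Or.inr hab, Or.inl rfl⟩
    obtain ⟨P, Q, hP, hQ, hd, hPQ, ha, hb⟩ := h p hpa hpb
    exact ⟨P, Q, hP, hQ, hd, hPQ, Or.inr ha, Or.inr hb⟩
  choose P Q hP hQ hd hPQ ha hb using hcut
  exact IsCutSystem.exists_homeomorph ⟨hP, hQ, hd, hPQ, ha, hb⟩ hab

section Order

variable {X : Type u} [TopologicalSpace X] {x : X}

theorem ord_le_natCast_iff {n : ℕ} : ord x ≤ n ↔ ∀ U : Set X, IsOpen U → x ∈ U →
    ∃ V : Set X, IsOpen V ∧ x ∈ V ∧ V ⊆ U ∧ (frontier V).encard ≤ n := by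
  have hcard (S : Set X) : Cardinal.mk S ≤ n ↔ S.encard ≤ n := Cardinal.toENat_le_natCast.symm
  simp only [ord_le_iff, hcard]

theorem exists_closure_subset_of_ord_le [RegularSpace X] {n : ℕ} (h : ord x ≤ n) {O : Set X}
    (hO : O ∈ 𝓝 x) :
    ∃ V : Set X, IsOpen V ∧ x ∈ V ∧ closure V ⊆ O ∧ (frontier V).encard ≤ n := by
  obtain ⟨F, hF, hFclosed, hFO⟩ := exists_mem_nhds_isClosed_subset hO
  obtain ⟨V, hV, hxV, hVF, hcard⟩ := ord_le_natCast_iff.1 h (interior F) isOpen_interior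
    (mem_interior_iff_mem_nhds.2 hF)
  exact ⟨V, hV, hxV, (closure_minimal (hVF.trans interior_subset) hFclosed).trans hFO, hcard⟩

variable [PreconnectedSpace X] [T1Space X] [Nontrivial X]

theorem ord_ne_zero (x : X) : ord x ≠ 0 := by
  intro h
  obtain ⟨y, hy⟩ := exists_ne x
  obtain ⟨V, -, hxV, hVy, hcard⟩ := (ord_le_natCast_iff (n := 0)).1 (mod_cast h.le) {y}ᶜ
    isOpen_compl_singleton hy.symm
  rw [Nat.cast_zero, nonpos_iff_eq_zero, encard_eq_zero, frontier_eq_empty_iff] at hcard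
  rcases hcard with rfl | rfl
  · exact hxV
  · exact hVy (mem_univ y) rfl

theorem ord_eq_two_iff : ord x = 2 ↔ x ∉ endpoints X ∪ branchpoints X := by
  simp only [endpoints, branchpoints, mem_union, mem_ofPred_eq, not_or, not_le]
  constructor
  · intro h
    rw [h]
    norm_num
  · rintro ⟨hone, hthree⟩
    obtain ⟨n, hn⟩ := Cardinal.lt_aleph0.1 (hthree.trans Cardinal.ofNat_lt_aleph0)
    have hzero := ord_ne_zero x
    rw [hn] at hone hthree hzero ⊢
    norm_cast at hone hthree hzero ⊢
    omega

end Order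

section IrreducibleContinua

section

variable {X : Type*} [TopologicalSpace X]

/-- `K` is irreducible between `a` and `b`: it is minimal among the closed connected sets
containing `a` and `b`. -/
structure IsIrreducibleBetween (a b : X) (K : Set X) : Prop where
  isClosed : IsClosed K
  isPreconnected : IsPreconnected K
  left_mem : a ∈ K
  right_mem : b ∈ K
  eq_of_subset : ∀ M ⊆ K, IsClosed M → IsPreconnected M → a ∈ M → b ∈ M → M = K

theorem exists_isIrreducibleBetween [CompactSpace X] [T2Space X] {a b : X} {M : Set X}
    (hM : IsClosed M) (hconn : IsPreconnected M) (ha : a ∈ M) (hb : b ∈ M) :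
    ∃ K ⊆ M, IsIrreducibleBetween a b K := by
  obtain ⟨K, hKM, hK⟩ := zorn_superset_nonempty
    {N : Set X | IsClosed N ∧ IsPreconnected N ∧ a ∈ N ∧ b ∈ N}
    (fun c hc hchain hne => ⟨⋂₀ c, ⟨isClosed_sInter fun N hN => (hc hN).1,
      isPreconnected_sInter_of_isChain hchain hne (fun N hN => (hc hN).1) fun N hN => (hc hN).2.1,
      fun N hN => (hc hN).2.2.1, fun N hN => (hc hN).2.2.2⟩,
      fun N hN => sInter_subset_of_mem hN⟩) M ⟨hM, hconn, ha, hb⟩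
  obtain ⟨hKclosed, hKconn, haK, hbK⟩ := hK.prop
  exact ⟨K, hKM, hKclosed, hKconn, haK, hbK, fun N hNK hN hNconn haN hbN =>
    hNK.antisymm (hK.2 ⟨hN, hNconn, haN, hbN⟩ hNK)⟩

theorem exists_isClosed_union_eq_of_disjoint {K D T T' : Set X} (hK : IsClosed K) (hD : IsOpen D)
    (hT' : IsClosed T') (hunion : T ∪ T' = K \ D) (hd : Disjoint T T') :
    ∃ S, IsClosed S ∧ K ∩ D ⊆ S ∧ T ∪ S = K ∧ T ∩ S ⊆ frontier D := by
  refine ⟨T' ∪ K ∩ closure D, hT'.union (hK.inter isClosed_closure),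
    (inter_subset_inter_right K subset_closure).trans subset_union_right, ?_, ?_⟩
  · rw [← union_assoc, hunion]
    refine Subset.antisymm (union_subset sdiff_subset inter_subset_left) fun z hz => ?_
    by_cases hzD : z ∈ D
    exacts [Or.inr ⟨hz, subset_closure hzD⟩, Or.inl ⟨hz, hzD⟩]
  · rintro z ⟨hzT, hzT' | ⟨-, hzD⟩⟩
    · exact (disjoint_left.1 hd hzT hzT').elim
    · rw [hD.frontier_eq]
      exact ⟨hzD, (hunion.subset (Or.inl hzT)).2⟩

theorem inter_frontier_nonempty_of_union_eq_diff {K D T T' : Set X} (hK : IsClosed K)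
    (hKconn : IsPreconnected K) (hD : IsOpen D) (hKD : (K ∩ D).Nonempty) (hT : IsClosed T)
    (hT' : IsClosed T') (hunion : T ∪ T' = K \ D) (hd : Disjoint T T') (hne : T.Nonempty) :
    (T ∩ frontier D).Nonempty := by
  obtain ⟨S, hS, hKDS, rfl, hTS⟩ := exists_isClosed_union_eq_of_disjoint hK hD hT' hunion hd
  obtain ⟨z, -, hzTS⟩ := isPreconnected_closed_iff.1 hKconn T S hT hS Subset.rfl
    (hne.mono fun z hz => ⟨Or.inl hz, hz⟩) (hKD.mono fun z hz => ⟨hz.1, hKDS hz⟩)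
  exact ⟨z, hzTS.1, hTS hzTS⟩

theorem isPreconnected_of_union_eq_diff {K D T T' : Set X} {c : X} (hK : IsClosed K)
    (hKconn : IsPreconnected K) (hD : IsOpen D) (hT : IsClosed T) (hT' : IsClosed T')
    (hunion : T ∪ T' = K \ D) (hd : Disjoint T T') (hc : c ∈ T) (hfr : T ∩ frontier D ⊆ {c}) :
    IsPreconnected T := by
  obtain ⟨S, hS, -, rfl, hTS⟩ := exists_isClosed_union_eq_of_disjoint hK hD hT' hunion hd
  exact isPreconnected_of_union_of_inter_subset_singleton hKconn hT hS
    ((subset_inter inter_subset_left hTS).trans hfr) hc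

/-- Each of the two pieces of a separation of `K \ D` meets the boundary of `D`, hence in exactly
one point, so both pieces are connected. -/
theorem exists_isPreconnected_union_eq_diff {K D : Set X} (hK : IsClosed K)
    (hKconn : IsPreconnected K) (hD : IsOpen D) (hKD : (K ∩ D).Nonempty)
    (hnot : ¬ IsPreconnected (K \ D)) (hcard : (frontier D).encard ≤ 2) :
    ∃ A B : Set X, IsClosed A ∧ IsClosed B ∧ IsPreconnected A ∧ IsPreconnected B ∧
      A ∪ B = K \ D ∧ frontier D ⊆ A ∪ B := by
  obtain ⟨A, B, hA, hB, hAne, hBne, hd, hunion⟩ :=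
    exists_isClosed_disjoint_union_eq_of_not_isPreconnected (hK.sdiff hD) hnot
  have hunion' : B ∪ A = K \ D := (union_comm B A).trans hunion
  obtain ⟨c, hcA, hc⟩ :=
    inter_frontier_nonempty_of_union_eq_diff hK hKconn hD hKD hA hB hunion hd hAne
  obtain ⟨d, hdB, hd'⟩ :=
    inter_frontier_nonempty_of_union_eq_diff hK hKconn hD hKD hB hA hunion' hd.symm hBne
  have hfr : {c, d} = frontier D :=
    Finite.eq_of_subset_of_encard_le (toFinite _) (pair_subset hc hd')
      (by rwa [encard_pair (hd.ne_of_mem hcA hdB)])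
  refine ⟨A, B, hA, hB,
    isPreconnected_of_union_eq_diff hK hKconn hD hA hB hunion hd hcA ?_,
    isPreconnected_of_union_eq_diff hK hKconn hD hB hA hunion' hd.symm hdB ?_, hunion,
    hfr ▸ pair_subset (Or.inl hcA) (Or.inr hdB)⟩
  all_goals
    rw [← hfr]
    rintro z ⟨hz, rfl | rfl⟩
  exacts [rfl, (disjoint_left.1 hd hz hdB).elim, (disjoint_left.1 hd hcA hz).elim, rfl]

/-- The union of the closed connected subsets of `S` that contain `a`. Unlike for connected
components, the witnessing sets are closed, so that minimality of an irreducible continuum applies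
to them. -/
def constituent (S : Set X) (a : X) : Set X :=
  {z | ∃ M ⊆ S, IsClosed M ∧ IsPreconnected M ∧ a ∈ M ∧ z ∈ M}

theorem constituent_subset (S : Set X) (a : X) : constituent S a ⊆ S :=
  fun _ ⟨_, hMS, _, _, _, hz⟩ => hMS hz

theorem mem_constituent_self [T1Space X] {S : Set X} {a : X} (ha : a ∈ S) : a ∈ constituent S a :=
  ⟨{a}, singleton_subset_iff.2 ha, isClosed_singleton, isPreconnected_singleton, rfl, rfl⟩

end

namespace IsIrreducibleBetween

variable {X : Type u} [TopologicalSpace X] {a b p : X} {K : Set X}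

theorem symm (hK : IsIrreducibleBetween a b K) : IsIrreducibleBetween b a K :=
  ⟨hK.isClosed, hK.isPreconnected, hK.right_mem, hK.left_mem,
    fun M hMK hM hconn hb ha => hK.eq_of_subset M hMK hM hconn ha hb⟩

theorem disjoint_constituent (hK : IsIrreducibleBetween a b K) (hp : p ∈ K) :
    Disjoint (constituent (K \ {p}) a) (constituent (K \ {p}) b) := by
  rw [disjoint_left]
  rintro z ⟨M, hMK, hM, hMconn, haM, hzM⟩ ⟨N, hNK, hN, hNconn, hbN, hzN⟩
  have hMNK : M ∪ N ⊆ K \ {p} := union_subset hMK hNK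
  have heq : M ∪ N = K := hK.eq_of_subset _ (hMNK.trans sdiff_subset) (hM.union hN)
    (hMconn.union z hzM hzN hNconn) (Or.inl haM) (Or.inr hbN)
  exact (hMNK (heq.superset hp)).2 rfl

theorem exists_union_eq_diff {D : Set X} (hK : IsIrreducibleBetween a b K) (hD : IsOpen D)
    (haD : a ∉ D) (hbD : b ∉ D) (hKD : (K ∩ D).Nonempty) (hcard : (frontier D).encard ≤ 2) :
    ∃ A B : Set X, IsClosed A ∧ IsClosed B ∧ IsPreconnected A ∧ IsPreconnected B ∧
      A ∪ B = K \ D ∧ a ∈ A ∧ b ∈ B ∧ frontier D ⊆ K := by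
  obtain ⟨q, hqK, hqD⟩ := hKD
  have hproper (M : Set X) (hM : M ⊆ K \ D) (hMclosed : IsClosed M) (hMconn : IsPreconnected M)
      (ha : a ∈ M) : b ∉ M := fun hb =>
    (hM ((hK.eq_of_subset M (hM.trans sdiff_subset) hMclosed hMconn ha hb).superset hqK)).2 hqD
  have haKD : a ∈ K \ D := ⟨hK.left_mem, haD⟩
  have hbKD : b ∈ K \ D := ⟨hK.right_mem, hbD⟩
  obtain ⟨A, B, hA, hB, hAconn, hBconn, hunion, hfr⟩ := exists_isPreconnected_union_eq_diff
    hK.isClosed hK.isPreconnected hD ⟨q, hqK, hqD⟩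
    (fun hconn => hproper _ Subset.rfl (hK.isClosed.sdiff hD) hconn haKD hbKD) hcard
  have hAK : A ⊆ K \ D := hunion ▸ subset_union_left
  have hBK : B ⊆ K \ D := hunion ▸ subset_union_right
  have hfrK : frontier D ⊆ K := hfr.trans (hunion.subset.trans sdiff_subset)
  rcases hunion.superset haKD with haA | haB
  · exact ⟨A, B, hA, hB, hAconn, hBconn, hunion, haA,
      (hunion.superset hbKD).resolve_left (hproper A hAK hA hAconn haA), hfrK⟩
  · exact ⟨B, A, hB, hA, hBconn, hAconn, (union_comm B A).trans hunion, haB,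
      (hunion.superset hbKD).resolve_right (hproper B hBK hB hBconn haB), hfrK⟩

variable [T2Space X] [RegularSpace X]

theorem constituent_mem_nhdsWithin_or {z : X} (hK : IsIrreducibleBetween a b K) (hp : p ∈ K)
    (hpa : p ≠ a) (hpb : p ≠ b) (hord : ord p ≤ 2) (hzp : z ≠ p) :
    constituent (K \ {p}) a ∈ 𝓝[K] z ∨ constituent (K \ {p}) b ∈ 𝓝[K] z := by
  obtain ⟨D, hD, hpD, hDO, hcard⟩ := exists_closure_subset_of_ord_le (n := 2) (mod_cast hord)
    (O := ({a, b, z} : Set X)ᶜ) ((toFinite _).isClosed.isOpen_compl.mem_nhds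
      (by simp [hpa, hpb, hzp.symm]))
  have hmem : ∀ w ∈ ({a, b, z} : Set X), w ∉ closure D := fun w hw h => hDO h hw
  obtain ⟨A, B, hA, hB, hAconn, hBconn, hunion, haA, hbB, -⟩ := hK.exists_union_eq_diff hD
    (fun h => hmem a (by simp) (subset_closure h)) (fun h => hmem b (by simp) (subset_closure h))
    ⟨p, hp, hpD⟩ hcard
  have hKD : K \ D ⊆ K \ {p} := sdiff_subset_sdiff_right (singleton_subset_iff.2 hpD)
  have hAa : A ⊆ constituent (K \ {p}) a := fun w hw =>
    ⟨A, (hunion ▸ subset_union_left : A ⊆ K \ D).trans hKD, hA, hAconn, haA, hw⟩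
  have hBb : B ⊆ constituent (K \ {p}) b := fun w hw =>
    ⟨B, (hunion ▸ subset_union_right : B ⊆ K \ D).trans hKD, hB, hBconn, hbB, hw⟩
  have hAB : Disjoint A B := (hK.disjoint_constituent hp).mono hAa hBb
  have hnear : ∀ᶠ w in 𝓝[K] z, w ∈ A ∪ B := by
    filter_upwards [self_mem_nhdsWithin, mem_nhdsWithin_of_mem_nhds
      (isClosed_closure.isOpen_compl.mem_nhds (hmem z (by simp)))] with w hwK hwD
    exact hunion.superset ⟨hwK, fun h => hwD (subset_closure h)⟩
  have hleave {C : Set X} (hC : IsClosed C) (hzC : z ∉ C) : ∀ᶠ w in 𝓝[K] z, w ∉ C :=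
    mem_nhdsWithin_of_mem_nhds (hC.isOpen_compl.mem_nhds hzC)
  by_cases hzB : z ∈ B
  · right
    filter_upwards [hnear, hleave hA (disjoint_right.1 hAB hzB)] with w hw hwA
    exact hBb (hw.resolve_left hwA)
  · left
    filter_upwards [hnear, hleave hB hzB] with w hw hwB
    exact hAa (hw.resolve_right hwB)

theorem isOpen_preimage_constituent (hK : IsIrreducibleBetween a b K) (hp : p ∈ K)
    (hpa : p ≠ a) (hpb : p ≠ b) (hord : ord p ≤ 2) :
    IsOpen (Subtype.val ⁻¹' constituent (K \ {p}) a : Set K) := by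
  refine isOpen_iff_mem_nhds.2 fun z hz => ?_
  rw [nhds_subtype_eq_comap_nhdsWithin]
  refine Filter.preimage_mem_comap ((hK.constituent_mem_nhdsWithin_or hp hpa hpb hord
    (constituent_subset _ _ hz).2).resolve_right fun hzb => ?_)
  exact disjoint_left.1 (hK.disjoint_constituent hp) hz (mem_of_mem_nhdsWithin z.2 hzb)

theorem exists_isOpen_union_eq_compl_singleton (hK : IsIrreducibleBetween a b K) {p : K}
    (hpa : (p : X) ≠ a) (hpb : (p : X) ≠ b) (hord : ord (p : X) ≤ 2) :
    ∃ P Q : Set K, IsOpen P ∧ IsOpen Q ∧ Disjoint P Q ∧ P ∪ Q = {p}ᶜ ∧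
      ⟨a, hK.left_mem⟩ ∈ P ∧ ⟨b, hK.right_mem⟩ ∈ Q := by
  refine ⟨Subtype.val ⁻¹' constituent (K \ {↑p}) a, Subtype.val ⁻¹' constituent (K \ {↑p}) b,
    hK.isOpen_preimage_constituent p.2 hpa hpb hord,
    hK.symm.isOpen_preimage_constituent p.2 hpb hpa hord,
    (hK.disjoint_constituent p.2).preimage _, Subset.antisymm ?_ fun z hz => ?_,
    mem_constituent_self ⟨hK.left_mem, hpa.symm⟩, mem_constituent_self ⟨hK.right_mem, hpb.symm⟩⟩
  · exact union_subset (fun z hz hzp => (constituent_subset _ _ hz).2 (congrArg Subtype.val hzp))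
      fun z hz hzp => (constituent_subset _ _ hz).2 (congrArg Subtype.val hzp)
  · rcases hK.constituent_mem_nhdsWithin_or p.2 hpa hpb hord fun h => hz (Subtype.ext h) with h | h
    exacts [Or.inl (mem_of_mem_nhdsWithin z.2 h :), Or.inr (mem_of_mem_nhdsWithin z.2 h :)]

theorem exists_isOpen_frontier_subset {O : Set X} (hK : IsIrreducibleBetween a b K) (hp : p ∈ K)
    (hpa : p ≠ a) (hpb : p ≠ b) (hord : ord p ≤ 2) (hO : O ∈ 𝓝 p) :
    ∃ D : Set X, IsOpen D ∧ p ∈ D ∧ closure D ⊆ O ∧ frontier D ⊆ K := by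
  obtain ⟨D, hD, hpD, hDO, hcard⟩ := exists_closure_subset_of_ord_le (n := 2) (mod_cast hord)
    (Filter.inter_mem hO ((toFinite ({a, b} : Set X)).isClosed.isOpen_compl.mem_nhds
      (by simp [hpa, hpb])))
  have hmem : ∀ w ∈ ({a, b} : Set X), w ∉ D := fun w hw h => (hDO (subset_closure h)).2 hw
  obtain ⟨-, -, -, -, -, -, -, -, -, hfr⟩ := hK.exists_union_eq_diff hD (hmem a (by simp))
    (hmem b (by simp)) ⟨p, hp, hpD⟩ hcard
  exact ⟨D, hD, hpD, hDO.trans inter_subset_left, hfr⟩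

/-- Otherwise a component of the complement of `K` accumulates at a point of `K` that has
arbitrarily small neighborhoods with boundary in `K`, which that component cannot leave. -/
theorem isOpen_diff_pair [CompactSpace X] [PreconnectedSpace X]
    (hK : IsIrreducibleBetween a b K) (hord : ∀ x ∈ K, ord x ≤ 2) : IsOpen (K \ {a, b}) := by
  have hstay {D : Set X} {y : X} (hfr : frontier D ⊆ K)
      (hyD : (connectedComponentIn Kᶜ y ∩ D).Nonempty) : connectedComponentIn Kᶜ y ⊆ D :=
    subset_of_isPreconnected_of_disjoint_frontier isPreconnected_connectedComponentIn hyD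
      (disjoint_left.2 fun z hz hzfr => connectedComponentIn_subset _ _ hz (hfr hzfr))
  have hsmall : ∀ q ∈ K \ {a, b}, ∀ O ∈ 𝓝 q,
      ∃ D : Set X, IsOpen D ∧ q ∈ D ∧ closure D ⊆ O ∧ frontier D ⊆ K := fun q hq O hO =>
    hK.exists_isOpen_frontier_subset hq.1 (fun h => hq.2 (Or.inl h)) (fun h => hq.2 (Or.inr h))
      (hord q hq.1) hO
  refine isOpen_iff_mem_nhds.2 fun q hq => ?_
  obtain ⟨D, hD, hqD, hDab, hfr⟩ := hsmall q hq _ ((toFinite {a, b}).isClosed.compl_mem_nhds hq.2)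
  filter_upwards [hD.mem_nhds hqD] with y hyD
  refine ⟨?_, hDab (subset_closure hyD)⟩
  by_contra hyK
  have hy : y ∈ connectedComponentIn Kᶜ y := mem_connectedComponentIn hyK
  obtain ⟨z, hzY, hzK⟩ :=
    closure_connectedComponentIn_compl_inter_nonempty hK.isClosed ⟨q, hq.1⟩ hyK
  have hzab : z ∉ ({a, b} : Set X) := hDab (closure_mono (hstay hfr ⟨y, hy, hyD⟩) hzY)
  obtain ⟨D', hD', hzD', hyD', hfr'⟩ := hsmall z ⟨hzK, hzab⟩ {y}ᶜ
    (isOpen_compl_singleton.mem_nhds fun h => hyK (h ▸ hzK))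
  obtain ⟨w, hwD', hwY⟩ := mem_closure_iff.1 hzY D' hD' hzD'
  exact hyD' (subset_closure (hstay hfr' ⟨w, hwY, hwD'⟩ hy)) rfl

theorem exists_isClosedEmbedding [CompactSpace X] [TopologicalSpace.MetrizableSpace X]
    (hK : IsIrreducibleBetween a b K) (hab : a ≠ b) (hord : ∀ x ∈ K, ord x ≤ 2) :
    ∃ g : I → X, IsClosedEmbedding g ∧ range g = K ∧ g 0 = a ∧ g 1 = b := by
  have : CompactSpace K := isCompact_iff_compactSpace.1 hK.isClosed.isCompact
  have : PreconnectedSpace K := isPreconnected_iff_preconnectedSpace.1 hK.isPreconnected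
  obtain ⟨e, he0, he1⟩ := exists_homeomorph_of_separating
    (a := (⟨a, hK.left_mem⟩ : K)) (b := ⟨b, hK.right_mem⟩) (fun h => hab (congrArg Subtype.val h))
    fun p hpa hpb => hK.exists_isOpen_union_eq_compl_singleton (fun h => hpa (Subtype.ext h))
      (fun h => hpb (Subtype.ext h)) (hord p p.2)
  refine ⟨Subtype.val ∘ e, hK.isClosed.isClosedEmbedding_subtypeVal.comp e.isClosedEmbedding, ?_,
    congrArg Subtype.val he0, congrArg Subtype.val he1⟩
  rw [e.surjective.range_comp, Subtype.range_val]

end IsIrreducibleBetween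

end IrreducibleContinua

section LocalEmbeddings

theorem isOpen_image_of_subset_interior_range {X Y : Type*} [TopologicalSpace X]
    [TopologicalSpace Y] {g : Y → X} (hg : IsInducing g) {O : Set Y} (hO : IsOpen O)
    (hgO : g '' O ⊆ interior (range g)) : IsOpen (g '' O) := by
  obtain ⟨W, hW, rfl⟩ := hg.isOpen_iff.1 hO
  rw [image_preimage_eq_inter_range] at hgO ⊢
  have heq : W ∩ range g = W ∩ interior (range g) :=
    (subset_inter inter_subset_left hgO).antisymm (inter_subset_inter_right W interior_subset)
  rw [heq]
  exact hW.inter isOpen_interior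

theorem frontier_image_eq_of_isOpen {X Y : Type*} [TopologicalSpace X] [TopologicalSpace Y]
    {g : Y → X} (hg : IsClosedEmbedding g) {O : Set Y} (hO : IsOpen O) (hgO : IsOpen (g '' O)) :
    frontier (g '' O) = g '' frontier O := by
  rw [hgO.frontier_eq, hO.frontier_eq, hg.closure_image_eq, image_sdiff hg.injective]

universe v

variable {X : Type u} {Y : Type v} [TopologicalSpace X] [TopologicalSpace Y] {g : Y → X} {t : Y}
  {n : ℕ}

theorem ord_image_le_natCast_iff (hg : IsClosedEmbedding g) (ht : range g ∈ 𝓝 (g t)) :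
    ord (g t) ≤ n ↔ ord t ≤ n := by
  have htint : g t ∈ interior (range g) := mem_interior_iff_mem_nhds.2 ht
  have hopen {O : Set Y} (hO : IsOpen O) (hOint : O ⊆ g ⁻¹' interior (range g)) :
      IsOpen (g '' O) :=
    isOpen_image_of_subset_interior_range hg.isInducing hO (image_subset_iff.2 hOint)
  rw [ord_le_natCast_iff, ord_le_natCast_iff]
  constructor <;> intro h U hU htU
  · have hpre : IsOpen (g ⁻¹' interior (range g)) := isOpen_interior.preimage hg.continuous
    obtain ⟨V, hV, htV, hVU, hcard⟩ := h _ (hopen (hU.inter hpre) inter_subset_right)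
      (mem_image_of_mem g ⟨htU, htint⟩)
    refine ⟨g ⁻¹' V, hV.preimage hg.continuous, htV, fun s hs => ?_, ?_⟩
    · exact (hg.injective.mem_set_image.1 (hVU hs)).1
    · rw [← hg.injective.encard_image]
      exact (encard_le_encard (image_subset_iff.2
        (hg.continuous.frontier_preimage_subset V))).trans hcard
  · obtain ⟨W, hW, htW, hWU, hcard⟩ := h _ ((hU.inter isOpen_interior).preimage hg.continuous)
      ⟨htU, htint⟩
    have hgW : IsOpen (g '' W) := hopen hW fun s hs => (hWU hs).2
    refine ⟨g '' W, hgW, mem_image_of_mem g htW, image_subset_iff.2 fun s hs => (hWU hs).1, ?_⟩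
    rwa [frontier_image_eq_of_isOpen hg hW hgW, hg.injective.encard_image]

theorem ord_image_eq_natCast_iff (hg : IsClosedEmbedding g) (ht : range g ∈ 𝓝 (g t)) :
    ord (g t) = n ↔ ord t = n := by
  have hle (m : ℕ) : ord (g t) ≤ m ↔ ord t ≤ m := ord_image_le_natCast_iff hg ht
  constructor <;> intro h
  · obtain ⟨m, hm⟩ := Cardinal.lt_aleph0.1 (((hle n).1 h.le).trans_lt Cardinal.natCast_lt_aleph0)
    simp only [h, hm, Nat.cast_le] at hle ⊢
    exact_mod_cast le_antisymm ((hle n).1 le_rfl) ((hle m).2 le_rfl)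
  · obtain ⟨m, hm⟩ := Cardinal.lt_aleph0.1 (((hle n).2 h.le).trans_lt Cardinal.natCast_lt_aleph0)
    simp only [h, hm, Nat.cast_le] at hle ⊢
    exact_mod_cast le_antisymm ((hle n).2 le_rfl) ((hle m).1 le_rfl)

end LocalEmbeddings

section UnitInterval

theorem ord_le_two_of_mem_Ioo {Y : Type u} [LinearOrder Y] [TopologicalSpace Y] [OrderTopology Y]
    [DenselyOrdered Y] {a b t : Y} (ht : t ∈ Ioo a b) : ord t ≤ 2 := by
  refine mod_cast ord_le_natCast_iff.2 fun U hU htU => ?_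
  obtain ⟨s, r, htsr, hsr⟩ :=
    (mem_nhds_iff_exists_Ioo_subset' ⟨a, ht.1⟩ ⟨b, ht.2⟩).1 (hU.mem_nhds htU)
  refine ⟨Ioo s r, isOpen_Ioo, htsr, hsr, ?_⟩
  rw [frontier_Ioo (htsr.1.trans htsr.2)]
  exact mod_cast (encard_pair (htsr.1.trans htsr.2).ne).le

theorem ord_bot_le_one {Y : Type u} [LinearOrder Y] [OrderBot Y] [Nontrivial Y]
    [TopologicalSpace Y] [OrderTopology Y] [DenselyOrdered Y] : ord (⊥ : Y) ≤ 1 := by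
  refine mod_cast ord_le_natCast_iff.2 fun U hU hbU => ?_
  obtain ⟨r, hr, hrU⟩ := nhds_bot_basis.mem_iff.1 (hU.mem_nhds hbU)
  refine ⟨Iio r, isOpen_Iio, hr, hrU, ?_⟩
  rw [frontier_Iio' ⟨⊥, hr⟩, encard_singleton, Nat.cast_one]

theorem ord_eq_two_of_mem_Ioo {Y : Type u} [ConditionallyCompleteLinearOrder Y]
    [TopologicalSpace Y] [OrderTopology Y] [DenselyOrdered Y] {a b t : Y} (ht : t ∈ Ioo a b) :
    ord t = 2 := by
  have hone : ¬ ord t ≤ 1 := fun h => by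
    obtain ⟨V, hV, htV, hVab, hcard⟩ :=
      (ord_le_natCast_iff (n := 1)).1 (mod_cast h) (Ioo a b) isOpen_Ioo ht
    have hmeets {J : Set Y} (hJ : J.OrdConnected) (htJ : t ∈ J) {s : Y} (hs : s ∈ J)
        (hsV : s ∉ V) : (J ∩ frontier V).Nonempty := not_disjoint_iff_nonempty_inter.1 fun hd =>
      hsV (subset_of_isPreconnected_of_disjoint_frontier hJ.isPreconnected ⟨t, htJ, htV⟩ hd hs)
    obtain ⟨s, hst, hs⟩ := hmeets ordConnected_Iic self_mem_Iic (mem_Iic.2 ht.1.le)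
      fun h => (hVab h).1.false
    obtain ⟨r, htr, hr⟩ := hmeets ordConnected_Ici self_mem_Ici (mem_Ici.2 ht.2.le)
      fun h => (hVab h).2.false
    have hsr : s = r := encard_le_one_iff.1 hcard s r hs hr
    have hst' : s = t := le_antisymm hst (hsr ▸ htr)
    exact (hV.frontier_eq.subset hs).2 (hst' ▸ htV)
  refine (ord_le_two_of_mem_Ioo ht).antisymm ?_
  rw [← one_add_one_eq_two]
  exact Cardinal.add_one_le_of_lt (not_le.1 hone)

theorem endpoints_unitInterval : endpoints I = {0, 1} := by
  refine Subset.antisymm (fun t ht => ?_) (pair_subset ?_ ?_)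
  · by_contra hne
    have h2 : ord t = 2 := ord_eq_two_of_mem_Ioo
      ⟨unitInterval.pos_iff_ne_zero.2 fun h => hne (Or.inl h),
        unitInterval.lt_one_iff_ne_one.2 fun h => hne (Or.inr h)⟩
    exact absurd (h2.symm.trans ht) (by norm_num)
  · exact ord_bot_le_one.antisymm (Cardinal.one_le_iff_ne_zero.2 (ord_ne_zero _))
  · exact (ord_bot_le_one (Y := Iᵒᵈ)).antisymm (Cardinal.one_le_iff_ne_zero.2 (ord_ne_zero _))

end UnitInterval

section Arcs

variable {X : Type u} [TopologicalSpace X] {g : I → X}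

theorem endpointsOf_range (hg : IsClosedEmbedding g) : endpointsOf (range g) = {g 0, g 1} := by
  let e : I ≃ₜ range g := hg.isEmbedding.toHomeomorph
  have hpre : e ⁻¹' endpoints (range g) = endpoints I := by
    ext t
    exact mod_cast ord_image_eq_natCast_iff (n := 1) e.isClosedEmbedding
      (by simp [e.surjective.range_eq])
  rw [endpointsOf, ← e.image_preimage (endpoints _), hpre, endpoints_unitInterval, image_pair,
    image_pair]
  rfl

theorem arcInterior_range (hg : IsClosedEmbedding g) :
    arcInterior (range g) = g '' Ioo 0 1 := by
  have hIcc : (univ : Set I) = Icc 0 1 := Icc_bot_top.symm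
  rw [arcInterior, endpointsOf_range hg, ← image_pair, ← image_univ, ← image_sdiff hg.injective,
    hIcc, Icc_sdiff_both]

theorem isFreeArc_range (hg : IsClosedEmbedding g) (hgo : IsOpen (g '' Ioo 0 1)) :
    IsFreeArc (range g) :=
  ⟨⟨hg.isEmbedding.toHomeomorph⟩, by rwa [arcInterior_range hg]⟩

theorem strictMono_convexComb {s r : I} (hsr : s < r) : StrictMono (Icc.convexComb s r) := by
  intro t u htu
  rw [← Subtype.coe_lt_coe, Icc.coe_convexComb, Icc.coe_convexComb]
  nlinarith [Subtype.coe_lt_coe.2 hsr, Subtype.coe_lt_coe.2 htu]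

theorem exists_isClosedEmbedding_range_eq_image_Icc (hg : IsClosedEmbedding g) {s r : I}
    (hsr : s < r) :
    ∃ f : I → X, IsClosedEmbedding f ∧ range f = g '' Icc s r ∧ f '' Ioo 0 1 = g '' Ioo s r := by
  have hmono : StrictMono (Icc.convexComb s r) := strictMono_convexComb hsr
  have hrange : range (Icc.convexComb s r) = Icc s r := by
    rw [Path.range_subpathAux, uIcc_of_le hsr.le]
  refine ⟨g ∘ Icc.convexComb s r,
    hg.comp ((Icc.continuous_convexComb s r).isClosedEmbedding hmono.injective),
    by rw [range_comp, hrange], ?_⟩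
  have hIcc : (univ : Set I) = Icc 0 1 := Icc_bot_top.symm
  rw [image_comp, ← Icc_sdiff_both, image_sdiff hmono.injective, ← hIcc, image_univ, hrange,
    image_pair, Icc.convexComb_zero, Icc.convexComb_one, Icc_sdiff_both]

theorem isFreeArc_image_Icc (hg : IsClosedEmbedding g) {s r : I} (hsr : s < r)
    (hgo : IsOpen (g '' Ioo s r)) :
    IsFreeArc (g '' Icc s r) ∧ arcInterior (g '' Icc s r) = g '' Ioo s r := by
  obtain ⟨f, hf, hrange, hIoo⟩ := exists_isClosedEmbedding_range_eq_image_Icc hg hsr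
  rw [← hrange, ← hIoo]
  exact ⟨isFreeArc_range hf (hIoo ▸ hgo), arcInterior_range hf⟩

variable {α : Set X}

theorem IsFreeArc.mem_nhds {x : X} (h : IsFreeArc α) (hx : x ∈ arcInterior α) : α ∈ 𝓝 x :=
  Filter.mem_of_superset (h.2.mem_nhds hx) sdiff_subset

variable [T2Space X]

theorem IsArc.exists_isClosedEmbedding (h : IsArc α) :
    ∃ g : I → X, IsClosedEmbedding g ∧ range g = α := by
  obtain ⟨e⟩ := h
  refine ⟨Subtype.val ∘ e, (continuous_subtype_val.comp e.continuous).isClosedEmbedding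
    (Subtype.val_injective.comp e.injective), ?_⟩
  rw [e.surjective.range_comp, Subtype.range_val]

theorem IsArc.finite_endpointsOf (h : IsArc α) : (endpointsOf α).Finite := by
  obtain ⟨g, hg, rfl⟩ := h.exists_isClosedEmbedding
  rw [endpointsOf_range hg]
  exact toFinite _

theorem IsArc.isConnected (h : IsArc α) : IsConnected α := by
  obtain ⟨g, hg, rfl⟩ := h.exists_isClosedEmbedding
  exact isConnected_range hg.continuous

theorem IsArc.isClosed (h : IsArc α) : IsClosed α := by
  obtain ⟨g, hg, rfl⟩ := h.exists_isClosedEmbedding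
  exact hg.isClosed_range

theorem IsFreeArc.ord_eq_two {x : X} (h : IsFreeArc α) (hx : x ∈ arcInterior α) : ord x = 2 := by
  have hα : α ∈ 𝓝 x := h.mem_nhds hx
  obtain ⟨g, hg, rfl⟩ := h.1.exists_isClosedEmbedding
  rw [arcInterior_range hg] at hx
  obtain ⟨t, ht, rfl⟩ := hx
  exact mod_cast (ord_image_eq_natCast_iff (n := 2) hg hα).2 (mod_cast ord_eq_two_of_mem_Ioo ht)

end Arcs

section Gaps

variable {Y : Type*} [LinearOrder Y]

/-- The pairs of endpoints of the bounded gaps of `F`, the maximal open intervals disjoint from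
`F` whose endpoints lie in `F`. They cut an open subset of an arc into free arcs. -/
def gaps (F : Set Y) : Set (Y × Y) :=
  {p | p.1 < p.2 ∧ p.1 ∈ F ∧ p.2 ∈ F ∧ Disjoint (Ioo p.1 p.2) F}

theorem pairwiseDisjoint_gaps (F : Set Y) :
    (gaps F).PairwiseDisjoint fun p => Ioo p.1 p.2 := by
  intro p hp q hq hne
  refine disjoint_left.2 fun t htp htq => hne ?_
  have hle {p q : Y × Y} (hp : p ∈ gaps F) (hq : q ∈ gaps F) (htp : t ∈ Ioo p.1 p.2)
      (htq : t ∈ Ioo q.1 q.2) : p.1 ≤ q.1 ∧ q.2 ≤ p.2 :=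
    ⟨not_lt.1 fun h => disjoint_left.1 hq.2.2.2 ⟨h, htp.1.trans htq.2⟩ hp.2.1,
      not_lt.1 fun h => disjoint_left.1 hq.2.2.2 ⟨htq.1.trans htp.2, h⟩ hp.2.2.1⟩
  exact Prod.ext ((hle hp hq htp htq).1.antisymm (hle hq hp htq htp).1)
    ((hle hq hp htq htp).2.antisymm (hle hp hq htp htq).2)

variable [TopologicalSpace Y]

theorem countable_gaps [OrderClosedTopology Y] [DenselyOrdered Y] [SecondCountableTopology Y]
    (F : Set Y) : (gaps F).Countable :=
  (pairwiseDisjoint_gaps F).countable_of_isOpen (fun _ _ => isOpen_Ioo)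
    fun _ hp => nonempty_Ioo.2 hp.1

theorem Ioo_diff_subset_iUnion_gaps [OrderClosedTopology Y] [CompactIccSpace Y] {F : Set Y}
    {a b : Y} (hF : IsClosed F) (ha : a ∈ F) (hb : b ∈ F) :
    Ioo a b \ F ⊆ ⋃ p ∈ gaps F, Ioo p.1 p.2 := by
  rintro t ⟨ht, htF⟩
  obtain ⟨p, ⟨hpF, hap, hpt⟩, hp⟩ := (isCompact_Icc.inter_left hF).exists_isGreatest
    ⟨a, ha, le_rfl, ht.1.le⟩
  obtain ⟨q, ⟨hqF, htq, hqb⟩, hq⟩ := (isCompact_Icc.inter_left hF).exists_isLeast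
    ⟨b, hb, ht.2.le, le_rfl⟩
  have hpt' : p < t := hpt.lt_of_ne fun h => htF (h ▸ hpF)
  have htq' : t < q := htq.lt_of_ne fun h => htF (h ▸ hqF)
  refine mem_biUnion (x := (p, q)) ⟨hpt'.trans htq', hpF, hqF, disjoint_left.2 fun z hz hzF => ?_⟩
    ⟨hpt', htq'⟩
  rcases le_total z t with hzt | htz
  · exact (hp ⟨hzF, hap.trans hz.1.le, hzt⟩).not_gt hz.1
  · exact (hq ⟨hzF, htz, hz.2.le.trans hqb⟩).not_gt hz.2

end Gaps

section FreeInterior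

variable {X : Type u} [TopologicalSpace X]

variable (X) in
/-- The set of points lying in the interior of a free arc; whether its complement is countable
mediates between the conditions on a tame graph. -/
def freeInterior : Set X :=
  ⋃ α ∈ {α : Set X | IsFreeArc α}, arcInterior α

theorem mem_freeInterior {x : X} : x ∈ freeInterior X ↔ ∃ α, IsFreeArc α ∧ x ∈ arcInterior α := by
  simp [freeInterior]

theorem isOpen_freeInterior : IsOpen (freeInterior X) :=
  isOpen_biUnion fun _ hα => hα.2

theorem IsArc.exists_pairwiseDisjoint_freeArcs [T2Space X] {α O : Set X} (hα : IsArc α)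
    (hO : IsOpen O) (hOα : O ⊆ arcInterior α) :
    ∃ P : Set (Set X), P.Countable ∧ (∀ β ∈ P, IsFreeArc β) ∧ P.PairwiseDisjoint arcInterior ∧
      ⋃ β ∈ P, arcInterior β = O := by
  obtain ⟨g, hg, rfl⟩ := hα.exists_isClosedEmbedding
  rw [arcInterior_range hg] at hOα
  let F : Set I := (g ⁻¹' O)ᶜ
  have hF : IsClosed F := (hO.preimage hg.continuous).isClosed_compl
  have hFO : g ⁻¹' O ⊆ Ioo 0 1 := fun t ht => hg.injective.mem_set_image.1 (hOα ht)
  have hgapO : ∀ p ∈ gaps F, g '' Ioo p.1 p.2 ⊆ O := fun p hp =>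
    image_subset_iff.2 (subset_compl_iff_disjoint_right.2 hp.2.2.2 |>.trans_eq (compl_compl _))
  have hOint : O ⊆ interior (range g) :=
    interior_maximal (hOα.trans (image_subset_range g _)) hO
  have hfree : ∀ p ∈ gaps F, IsFreeArc (g '' Icc p.1 p.2) ∧
      arcInterior (g '' Icc p.1 p.2) = g '' Ioo p.1 p.2 := fun p hp =>
    isFreeArc_image_Icc hg hp.1 (isOpen_image_of_subset_interior_range hg.isInducing isOpen_Ioo
      ((hgapO p hp).trans hOint))
  refine ⟨(fun p => g '' Icc p.1 p.2) '' gaps F, (countable_gaps F).image _,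
    forall_mem_image.2 fun p hp => (hfree p hp).1, ?_, ?_⟩
  · rintro _ ⟨p, hp, rfl⟩ _ ⟨q, hq, rfl⟩ hne
    simp only [Function.onFun, (hfree p hp).2, (hfree q hq).2]
    exact disjoint_image_of_injective hg.injective
      (pairwiseDisjoint_gaps F hp hq fun h => hne (h ▸ rfl))
  · rw [biUnion_image]
    refine (iUnion₂_subset fun p hp => (hfree p hp).2.trans_subset (hgapO p hp)).antisymm ?_
    intro x hx
    obtain ⟨t, ht, rfl⟩ := hOα hx
    obtain ⟨p, hp, htp⟩ := mem_iUnion₂.1 (Ioo_diff_subset_iUnion_gaps hF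
      (fun h => (hFO h).1.false) (fun h => (hFO h).2.false) ⟨ht, fun h => h hx⟩)
    exact mem_biUnion hp ((hfree p hp).2.superset (mem_image_of_mem g htp))

theorem subset_freeInterior_of_subset_arcInterior [T2Space X] {α O : Set X} (hα : IsArc α)
    (hO : IsOpen O) (hOα : O ⊆ arcInterior α) : O ⊆ freeInterior X := by
  obtain ⟨P, -, hfree, -, rfl⟩ := hα.exists_pairwiseDisjoint_freeArcs hO hOα
  exact biUnion_subset_biUnion_left hfree

theorem exists_countable_biUnion_arcInterior_eq [SecondCountableTopology X] :
    ∃ 𝒜 : Set (Set X), 𝒜.Countable ∧ (∀ α ∈ 𝒜, IsFreeArc α) ∧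
      ⋃ α ∈ 𝒜, arcInterior α = freeInterior X := by
  obtain ⟨𝒜, hfree, hcount, hunion⟩ := TopologicalSpace.isOpen_biUnion_countable
    {α : Set X | IsFreeArc α} arcInterior fun _ hα => hα.2
  exact ⟨𝒜, hcount, hfree, hunion⟩

theorem countable_compl_freeInterior_of_freeArcs [T2Space X] {𝒜 : Set (Set X)}
    (h𝒜 : 𝒜.Countable) (hfree : ∀ α ∈ 𝒜, IsFreeArc α) (hcompl : (⋃₀ 𝒜)ᶜ.Countable) :
    (freeInterior X)ᶜ.Countable := by
  have hends : (⋃ α ∈ 𝒜, endpointsOf α).Countable :=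
    h𝒜.biUnion fun α hα => (hfree α hα).1.finite_endpointsOf.countable
  refine (hcompl.union hends).mono fun x hx => or_iff_not_imp_left.2 fun hx𝒜 => ?_
  obtain ⟨α, hα, hxα⟩ := not_not.1 hx𝒜
  exact mem_biUnion hα (by_contra fun hxE => hx (mem_freeInterior.2 ⟨α, hfree α hα, hxα, hxE⟩))

theorem isTameGraph_of_countable_compl_freeInterior [T2Space X]
    (h : (freeInterior X)ᶜ.Countable) : IsTameGraph X := by
  refine h.mono (closure_minimal ?_ isOpen_freeInterior.isClosed_compl)
  intro x hx hxfree
  obtain ⟨α, hα, hxα⟩ := mem_freeInterior.1 hxfree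
  have hord : ord x = 2 := hα.ord_eq_two hxα
  rcases hx with hx | hx
  · exact absurd (hord.symm.trans hx) (by norm_num)
  · exact absurd ((show 3 ≤ ord x from hx).trans_eq hord) (by norm_num)

end FreeInterior

section OrderTwo

variable {X : Type u} [TopologicalSpace X] [CompactSpace X]

theorem IsIrreducibleBetween.ord_left_le_one_of_mem_nhds [TopologicalSpace.MetrizableSpace X]
    {a b : X} {K : Set X} (hK : IsIrreducibleBetween a b K) (hab : a ≠ b)
    (hord : ∀ x ∈ K, ord x ≤ 2) (hKa : K ∈ 𝓝 a) : ord a ≤ 1 := by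
  obtain ⟨g, hg, rfl, rfl, -⟩ := hK.exists_isClosedEmbedding hab hord
  exact mod_cast (ord_image_le_natCast_iff (n := 1) hg hKa).2 (mod_cast ord_bot_le_one)

variable [PreconnectedSpace X]

theorem exists_isIrreducibleBetween_subset_of_isOpen [T2Space X] [Nontrivial X] {U : Set X} {x : X}
    (hU : IsOpen U) (hx : x ∈ U) : ∃ b ≠ x, ∃ K ⊆ U, IsIrreducibleBetween x b K := by
  obtain ⟨y, hy⟩ := exists_ne x
  obtain ⟨F, hF, hFclosed, hFU⟩ := exists_mem_nhds_isClosed_subset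
    ((hU.inter isOpen_compl_singleton).mem_nhds ⟨hx, hy.symm⟩)
  have hxF : x ∈ interior F := mem_interior_iff_mem_nhds.2 hF
  obtain ⟨b, hbC, hbfr⟩ := connectedComponentIn_inter_frontier_nonempty hFclosed
    (interior_subset hxF) fun h => (hFU (h.superset (mem_univ y))).2 rfl
  obtain ⟨K, hKC, hK⟩ := exists_isIrreducibleBetween
    (isClosed_connectedComponentIn hFclosed) isPreconnected_connectedComponentIn
    (mem_connectedComponentIn (interior_subset hxF)) hbC
  exact ⟨b, fun h => hbfr.2 (h ▸ hxF), K,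
    fun z hz => (hFU (connectedComponentIn_subset _ _ (hKC hz))).1, hK⟩

variable [TopologicalSpace.MetrizableSpace X] {a b : X} {K : Set X}

theorem IsIrreducibleBetween.isFreeArc (hK : IsIrreducibleBetween a b K) (hab : a ≠ b)
    (hord : ∀ x ∈ K, ord x ≤ 2) : IsFreeArc K ∧ arcInterior K = K \ {a, b} := by
  have hopen : IsOpen (K \ {a, b}) := hK.isOpen_diff_pair hord
  obtain ⟨g, hg, rfl, rfl, rfl⟩ := hK.exists_isClosedEmbedding hab hord
  have hInt : arcInterior (range g) = range g \ {g 0, g 1} := by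
    rw [arcInterior, endpointsOf_range hg]
  exact ⟨⟨⟨hg.isEmbedding.toHomeomorph⟩, hInt ▸ hopen⟩, hInt⟩

theorem IsIrreducibleBetween.exists_isPreconnected_inter_subset_singleton
    (hK : IsIrreducibleBetween a b K) (hab : a ≠ b) (hord : ∀ x ∈ K, ord x ≤ 2)
    (hone : ¬ ord a ≤ 1) {U : Set X} (hU : U ∈ 𝓝 a) :
    ∃ M ⊆ U, IsClosed M ∧ IsPreconnected M ∧ a ∈ M ∧ M ∩ K ⊆ {a} ∧ ∃ c ∈ M, c ≠ a := by
  obtain ⟨F, hF, hFclosed, hFU⟩ :=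
    exists_mem_nhds_isClosed_subset (Filter.inter_mem hU (isOpen_compl_singleton.mem_nhds hab))
  have hZ : IsClosed (F \ (K \ {a, b})) := hFclosed.sdiff (hK.isOpen_diff_pair hord)
  have hZK : F \ (K \ {a, b}) ∩ K ⊆ {a} := fun z hz => by_contra fun hza =>
    hz.1.2 ⟨hz.2, fun h => h.elim hza (hFU hz.1.1).2⟩
  have haZ : a ∈ F \ (K \ {a, b}) := ⟨mem_of_mem_nhds hF, fun h => h.2 (Or.inl rfl)⟩
  refine ⟨connectedComponentIn (F \ (K \ {a, b})) a,
    fun z hz => (hFU (connectedComponentIn_subset _ _ hz).1).1, isClosed_connectedComponentIn hZ,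
    isPreconnected_connectedComponentIn, mem_connectedComponentIn haZ,
    (inter_subset_inter_left K (connectedComponentIn_subset _ _)).trans hZK, ?_⟩
  by_contra! hcomp
  have hfr : ∀ᶠ z in 𝓝 a, z ∈ frontier (F \ (K \ {a, b})) → z = a := by
    filter_upwards [interior_mem_nhds.2 hF] with z hzF hz
    refine hZK ⟨hZ.frontier_subset hz, by_contra fun hzK => hz.2 ?_⟩
    refine mem_interior.2 ⟨interior F \ K, ?_, isOpen_interior.sdiff hK.isClosed, hzF, hzK⟩
    exact fun w hw => ⟨interior_subset hw.1, fun h => hw.2 h.1⟩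
  refine hone (hK.ord_left_le_one_of_mem_nhds hab hord ?_)
  filter_upwards [hF, eventually_eq_of_connectedComponentIn_subset_singleton hZ haZ hfr hcomp]
    with z hzF hz
  exact by_contra fun hzK => hzK (hz ⟨hzF, fun h => hzK h.1⟩ ▸ hK.left_mem)

/-- The arc `K` that starts at `x` is continued beyond `x` by a continuum `M`, so that `x` is
an inner point of an arc in `M ∪ K`. -/
theorem mem_freeInterior_of_ord_le_two [Nontrivial X] {U : Set X} (hU : IsOpen U)
    (hord : ∀ z ∈ U, ord z ≤ 2) {x : X} (hx : x ∈ U) (hone : ¬ ord x ≤ 1) :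
    x ∈ freeInterior X := by
  obtain ⟨b, hbx, K, hKU, hK⟩ := exists_isIrreducibleBetween_subset_of_isOpen hU hx
  obtain ⟨M, hMU, hM, hMconn, hxM, hMK, c, hcM, hcx⟩ :=
    hK.exists_isPreconnected_inter_subset_singleton hbx.symm (fun z hz => hord z (hKU hz)) hone
      (hU.mem_nhds hx)
  obtain ⟨L, hLMK, hL⟩ := exists_isIrreducibleBetween (hM.union hK.isClosed)
    (hMconn.union x hxM hK.left_mem hK.isPreconnected) (Or.inl hcM) (Or.inr hK.right_mem)
  have hcb : c ≠ b := fun h => hcx (hMK ⟨hcM, h ▸ hK.right_mem⟩)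
  have hxL : x ∈ L := by
    obtain ⟨z, hzL, hzMK⟩ := isPreconnected_closed_iff.1 hL.isPreconnected M K hM hK.isClosed
      hLMK ⟨c, hL.left_mem, hcM⟩ ⟨b, hL.right_mem, hK.right_mem⟩
    exact hMK hzMK ▸ hzL
  obtain ⟨hfree, hInt⟩ := hL.isFreeArc hcb fun z hz =>
    hord z (union_subset hMU hKU (hLMK hz))
  refine mem_freeInterior.2 ⟨L, hfree, hInt.superset ⟨hxL, ?_⟩⟩
  rintro (h | h)
  exacts [hcx h.symm, hbx h.symm]

theorem IsTameGraph.countable_compl_freeInterior (h : IsTameGraph X) :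
    (freeInterior X)ᶜ.Countable := by
  cases subsingleton_or_nontrivial X
  · exact subsingleton_of_subsingleton.countable
  refine h.mono fun x hx => by_contra fun hxcl => hx ?_
  have hord : ∀ z ∈ (closure (endpoints X ∪ branchpoints X))ᶜ, ord z = 2 := fun z hz =>
    ord_eq_two_iff.2 fun h => hz (subset_closure h)
  exact mem_freeInterior_of_ord_le_two isClosed_closure.isOpen_compl (fun z hz => (hord z hz).le)
    hxcl (by norm_num [hord x hxcl])

end OrderTwo

section TamePartitions

variable {X : Type u} [TopologicalSpace X] [T2Space X]

theorem exists_isTamePartition_of_seq {α : ℕ → Set X} (hα : ∀ n, IsFreeArc (α n))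
    (hcompl : (⋃ n, α n)ᶜ.Countable) : ∃ P : Set (Set X), IsTamePartition P := by
  have hO (n : ℕ) : IsOpen (disjointed α n \ endpointsOf (α n)) := by
    rw [disjointed_eq_inter_compl, inter_sdiff_right_comm]
    exact (hα n).2.inter
      ((finite_lt_nat n).isOpen_biInter fun k _ => (hα k).1.isClosed.isOpen_compl)
  choose P hcount hfree hdisj hunion using fun n =>
    (hα n).1.exists_pairwiseDisjoint_freeArcs (hO n)
      (sdiff_subset_sdiff_left (disjointed_subset α n))
  have hInt {n : ℕ} {β : Set X} (hβ : β ∈ P n) : arcInterior β ⊆ disjointed α n :=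
    (hunion n ▸ subset_biUnion_of_mem hβ : _ ⊆ disjointed α n \ _).trans sdiff_subset
  have hends : (⋃ n, endpointsOf (α n)).Countable :=
    countable_iUnion fun n => (hα n).1.finite_endpointsOf.countable
  refine ⟨⋃ n, P n, countable_iUnion hcount, ?_, ?_, (hcompl.union hends).mono ?_⟩
  · exact fun β hβ => (mem_iUnion.1 hβ).elim fun n => hfree n β
  · intro β hβ γ hγ hne
    obtain ⟨m, hm⟩ := mem_iUnion.1 hβ
    obtain ⟨n, hn⟩ := mem_iUnion.1 hγ
    obtain rfl | hmn := eq_or_ne m n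
    exacts [hdisj m hm hn hne, (disjoint_disjointed α hmn).mono (hInt hm) (hInt hn)]
  · intro x hx
    by_contra! hcon
    obtain ⟨hxα, hxE⟩ := not_or.1 hcon
    obtain ⟨n, hn⟩ := mem_iUnion.1 (iUnion_disjointed.superset (not_not.1 hxα))
    obtain ⟨β, hβ, hxβ⟩ := mem_iUnion₂.1
      ((hunion n).superset ⟨hn, fun h => hxE (mem_iUnion_of_mem n h)⟩)
    exact hx ⟨β, mem_iUnion_of_mem n hβ, hxβ.1⟩

theorem exists_isTamePartition {𝒜 : Set (Set X)} (h𝒜 : 𝒜.Countable)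
    (hfree : ∀ α ∈ 𝒜, IsFreeArc α) (hcompl : (⋃₀ 𝒜)ᶜ.Countable) :
    ∃ P : Set (Set X), IsTamePartition P := by
  rcases 𝒜.eq_empty_or_nonempty with rfl | hne
  · exact ⟨∅, countable_empty, hfree, by simp, hcompl⟩
  · obtain ⟨α, rfl⟩ := h𝒜.exists_eq_range hne
    exact exists_isTamePartition_of_seq (forall_mem_range.1 hfree) (by rwa [sUnion_range] at hcompl)

end TamePartitions

section FiniteGraphs

variable {X : Type u} [TopologicalSpace X] [T2Space X]

theorem IsArc.isFiniteGraph {α : Set X} (h : IsArc α) : IsFiniteGraph α := by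
  refine ⟨h.isConnected, {α}, finite_singleton α, by simpa using h, ?_, sUnion_singleton α⟩
  rintro _ rfl _ rfl hne
  exact (hne rfl).elim

theorem IsFiniteGraph.countable_interior_diff_freeInterior {N : Set X} (h : IsFiniteGraph N) :
    (interior N \ freeInterior X).Countable := by
  obtain ⟨-, 𝒜, hfin, harc, hinter, rfl⟩ := h
  have hends : (⋃ α ∈ 𝒜, endpointsOf α).Countable :=
    hfin.countable.biUnion fun α hα => (harc α hα).finite_endpointsOf.countable
  refine hends.mono ?_
  rintro x ⟨hxint, hxfree⟩
  obtain ⟨α, hα, hxα⟩ := interior_subset hxint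
  refine mem_biUnion hα (by_contra fun hxE => hxfree ?_)
  have hothers : IsClosed (⋃ β ∈ 𝒜 \ {α}, β) :=
    hfin.sdiff.isClosed_biUnion fun β hβ => (harc β hβ.1).isClosed
  have hxothers : x ∉ ⋃ β ∈ 𝒜 \ {α}, β := fun hx => by
    obtain ⟨β, ⟨hβ, hne⟩, hxβ⟩ := mem_iUnion₂.1 hx
    exact hxE (hinter α hα β hβ (Ne.symm hne) ⟨hxα, hxβ⟩).1
  refine subset_freeInterior_of_subset_arcInterior (harc α hα)
    ((isOpen_interior.sdiff hothers).sdiff (harc α hα).finite_endpointsOf.isClosed) ?_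
    ⟨⟨hxint, hxothers⟩, hxE⟩
  rintro z ⟨⟨hzint, hzothers⟩, hzE⟩
  obtain ⟨β, hβ, hzβ⟩ := interior_subset hzint
  obtain rfl : β = α := by_contra fun h => hzothers (mem_biUnion ⟨hβ, h⟩ hzβ)
  exact ⟨hzβ, hzE⟩

theorem countable_compl_freeInterior_iff [SecondCountableTopology X] :
    (freeInterior X)ᶜ.Countable ↔ {x : X | ¬ ∃ N ∈ 𝓝 x, IsFiniteGraph N}.Countable := by
  constructor
  · intro h
    refine h.mono ?_
    intro x hx hxfree
    refine hx ?_
    obtain ⟨α, hα, hxα⟩ := mem_freeInterior.1 hxfree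
    exact ⟨α, hα.mem_nhds hxα, hα.1.isFiniteGraph⟩
  · intro h
    obtain ⟨𝒩, h𝒩, hcount, hunion⟩ := TopologicalSpace.isOpen_biUnion_countable
      {N : Set X | IsFiniteGraph N} interior fun _ _ => isOpen_interior
    have hdiff : (⋃ N ∈ 𝒩, interior N \ freeInterior X).Countable :=
      hcount.biUnion fun N hN => (h𝒩 hN).countable_interior_diff_freeInterior
    refine (h.union hdiff).mono fun x hx => or_iff_not_imp_left.2 fun hxN => ?_
    obtain ⟨N, hN, hNgraph⟩ := not_not.1 hxN
    obtain ⟨N', hN', hxN'⟩ := mem_iUnion₂.1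
      (hunion.superset (mem_biUnion hNgraph (mem_interior_iff_mem_nhds.2 hN)))
    exact mem_biUnion hN' ⟨hxN', hx⟩

end FiniteGraphs

end TameGraph

theorem mainTheorem11 (G : Type u) [TopologicalSpace G] [TopologicalSpace.MetrizableSpace G]
    [CompactSpace G] [ConnectedSpace G] :
    List.TFAE
      [TameGraph.IsTameGraph G,
       ∃ (𝒜 : Set (Set G)) (C : Set G), 𝒜.Countable ∧ (∀ α ∈ 𝒜, TameGraph.IsFreeArc α) ∧
         C.Countable ∧ ⋃₀ 𝒜 ∪ C = univ,
       ∃ P : Set (Set G), TameGraph.IsTamePartition P,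
       {x : G | ¬ ∃ N ∈ 𝓝 x, TameGraph.IsFiniteGraph N}.Countable] := by
  have : SecondCountableTopology G :=
    let := TopologicalSpace.metrizableSpaceMetric G
    inferInstance
  tfae_have 1 → 2 := fun htame => by
    obtain ⟨𝒜, hcount, hfree, hunion⟩ := TameGraph.exists_countable_biUnion_arcInterior_eq (X := G)
    have hcover : TameGraph.freeInterior G ⊆ ⋃₀ 𝒜 := by
      rw [← hunion, sUnion_eq_biUnion]
      exact iUnion₂_mono fun α _ => sdiff_subset
    exact ⟨𝒜, (⋃₀ 𝒜)ᶜ, hcount, hfree,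
      htame.countable_compl_freeInterior.mono (compl_subset_compl.2 hcover), union_compl_self _⟩
  tfae_have 2 → 3 := by
    rintro ⟨𝒜, C, hcount, hfree, hC, hcover⟩
    exact TameGraph.exists_isTamePartition hcount hfree
      (hC.mono (compl_subset_iff_union.2 hcover))
  tfae_have 3 → 4 := by
    rintro ⟨P, hcount, hfree, -, hcompl⟩
    exact TameGraph.countable_compl_freeInterior_iff.1
      (TameGraph.countable_compl_freeInterior_of_freeArcs hcount hfree hcompl)
  tfae_have 4 → 1 := fun hgraph => TameGraph.isTameGraph_of_countable_compl_freeInterior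
    (TameGraph.countable_compl_freeInterior_iff.2 hgraph)
  tfae_finish
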